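/- Let $K\ge 0$ and $N\ge 1$ be integers, and let $\mathbf S^{K+2}$ be the space of symmetric real $(K+2)\times(K+2)$ matrices, $\mathbf S_+^{K+2}$ its cone of positive semidefinite matrices. On $\mathbf S^{K+2}\times\mathbf R^{K+1}$ put $\langle (X,Y),(G,F)\rangle=\operatorname{tr}(X^TG)+Y^TF$, let $\|\cdot\|$ be any norm on this space and $\|\cdot\|_*$ its dual norm with respect to $\langle\cdot,\cdot\rangle$. Let $I=\{\star,0,\dots,K\}$ and $M=\{(i,j)\in I\times I: i\ne j\}$. Let $(A_m,b_m)$ $(m\in M)$, $(A_0,b_0)$, $(A_{\rm obj},b_{\rm obj})$ be elements of $\mathbf S^{K+2}\times\mathbf R^{K+1}$ and $c_0\in\mathbf R$, and set $$\mathcal F=\{(G,F): G\in\mathbf S_+^{K+2},\ \langle (A_m,b_m),(G,F)\rangle\le 0\ \ \forall m\in M\},\qquad \mathcal X=\{(G,F): G\in\mathbf S_+^{K+2},\ \langle (A_0,b_0),(G,F)\rangle+c_0\le 0\},$$ $$\phi_K(Z)=\langle (A_{\rm obj},b_{\rm obj}),Z\rangle,\qquad \mathcal S^*(y)=-\sum_{m\in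 M}y_m(A_m,b_m)\quad(y\in\mathbf R^{M}).$$ Here $\mathcal F$ encodes the interpolation conditions of a function class, $\mathcal X$ the initial condition and $\phi_K$ the performance metric, in terms of Gram matrix $G$ and function values $F$. Let $\widehat Z_1,\dots,\widehat Z_N\in\mathcal F\cap\mathcal X$ be samples. For $J\ge1$ and given $(A^j_{\rm obj},b^j_{\rm obj})\in\mathbf S^{K+2}\times\mathbf R^{K+1}$, $c^j_{\rm obj}\in\mathbf R$ $(1\le j\le J)$ and $\varepsilon>0$, the problem (DRO-PEP) is $$\begin{array}{ll}\text{minimize} & \frac1N\sum_{i=1}^N s_i\\ \text{subject to} & c^j_{\rm obj}t-c_0\tau_i^j-\langle (X_i^j,Y_i^j),\widehat Z_i\rangle+\lambda\varepsilon\le s_i,\\ & -\mathcal S^*(y_i^j)-(X_i^j,Y_i^j)+\tau_i^j(A_0,b_0)-(A^j_{\rm obj},b^j_{\rm obj})\in\mathbf S_+^{K+2}\times\{0\},\\ & \|(X_i^j,Y_i^j)\|_*\le\lambda,\qquad i=1,\dots,N,\ j=1,\dots,J,\end{array}$$ with variables $s_i,t\in\mathbf R$, $\tau_i^j,\lambda\in\mathbf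 R_+$, $(X_i^j,Y_i^j)\in\mathbf S^{K+2}\times\mathbf R^{K+1}$, $y_i^j\in\mathbf R_+^{M}$; its optimal value is the infimum in $[-\infty,\infty]$. Let $E(\varepsilon)$ be its optimal value for $J=1$, $(A^1_{\rm obj},b^1_{\rm obj},c^1_{\rm obj})=(A_{\rm obj},b_{\rm obj},0)$, and, for $\alpha\in(0,1]$, let $C_\alpha(\varepsilon)$ be its optimal value for $J=2$, $(A^1_{\rm obj},b^1_{\rm obj},c^1_{\rm obj})=(\alpha^{-1}A_{\rm obj},\alpha^{-1}b_{\rm obj},1-\alpha^{-1})$, $(A^2_{\rm obj},b^2_{\rm obj},c^2_{\rm obj})=(0,0,1)$. (i) As $\varepsilon\downarrow0$, $E(\varepsilon)\to\frac1N\sum_{i=1}^N\phi_K(\widehat Z_i)$, and for every $\alpha\in(0,1]$ $$C_\alpha(\varepsilon)\to\inf_{t\in\mathbf R}\Big(t+\frac{\alpha^{-1}}N\sum_{i=1}^N(\phi_K(\widehat Z_i)-t)_+\Big)=\sup\Big\{\frac{\alpha^{-1}}N\sum_{i=1}^N\alpha_i\phi_K(\widehat Z_i)\ :\ \alpha_i\in[0,1],\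 \frac1N\sum_{i=1}^N\alpha_i=\alpha\Big\}.$$ (ii) Suppose that $\mathcal F\cap\mathcal X$ is compact. Then $$\sup_{Z\in\mathcal F\cap\mathcal X}\phi_K(Z)=\inf\big\{-c_0\tau\ :\ \tau\in\mathbf R_+,\ y\in\mathbf R_+^{M},\ -\mathcal S^*(y)+\tau(A_0,b_0)-(A_{\rm obj},b_{\rm obj})\in\mathbf S_+^{K+2}\times\{0\}\big\},$$ and there is $\bar\varepsilon>0$ such that for all $\varepsilon\ge\bar\varepsilon$ and all $\alpha\in(0,1]$, both $E(\varepsilon)$ and $C_\alpha(\varepsilon)$ equal $\sup_{Z\in\mathcal F\cap\mathcal X}\phi_K(Z)$. -/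

import Mathlib

open Filter Topology

noncomputable section

namespace DroPep

/-- The space of symmetric real `n × n` matrices. -/
def symMat (n : ℕ) : Submodule ℝ (Matrix (Fin n) (Fin n) ℝ) where
  carrier := {A | A.IsSymm}
  add_mem' := fun ha hb => Matrix.IsSymm.add ha hb
  zero_mem' := Matrix.isSymm_zero
  smul_mem' := fun c _ ha => Matrix.IsSymm.smul ha c

/-- The lifted space of pairs `Z = (G, F)`: a symmetric matrix `G` of size `K + 2` and a vector `F`
of length `K + 1`. -/
abbrev Lifted (K : ℕ) : Type := symMat (K + 2) × (Fin (K + 1) → ℝ)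

/-- `⟨(X, Y), (G, F)⟩ = tr (Xᵀ G) + Yᵀ F`. -/
def pairing {K : ℕ} (W Z : Lifted K) : ℝ :=
  ((W.1 : Matrix (Fin (K + 2)) (Fin (K + 2)) ℝ).transpose *
    (Z.1 : Matrix (Fin (K + 2)) (Fin (K + 2)) ℝ)).trace + W.2 ⬝ᵥ Z.2

/-- The index set `I = {⋆, 0, …, K}`; `none` is the index `⋆` of the optimal point. -/
abbrev PointIdx (K : ℕ) : Type := Option (Fin (K + 1))

/-- The set `M` of ordered pairs of distinct indices. -/
abbrev PairIdx (K : ℕ) : Type := {m : PointIdx K × PointIdx K // m.1 ≠ m.2}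

/-- The data of a performance estimation problem: the coefficients `(A_m, b_m)` of the interpolation
conditions `⟨(A_m, b_m), Z⟩ ≤ 0`, the initial condition `⟨(A₀, b₀), Z⟩ + c₀ ≤ 0`, and the performance
metric `⟨(A_obj, b_obj), Z⟩`. -/
structure Data (K : ℕ) where
  interp : PairIdx K → Lifted K
  init : Lifted K
  c₀ : ℝ
  obj : Lifted K

variable {K : ℕ}

/-- The operator `𝒮 (Z) = (- ⟨(A_m, b_m), Z⟩)_m`. -/
def Data.S (D : Data K) (Z : Lifted K) : PairIdx K → ℝ :=
  fun m => - pairing (D.interp m) Z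

/-- The adjoint operator `𝒮* (y) = - ∑ m, y_m (A_m, b_m)`. -/
def Data.adjS (D : Data K) (y : PairIdx K → ℝ) : Lifted K :=
  - ∑ m, y m • D.interp m

/-- The set `ℱ` of pairs `(G, F)` with `G ⪰ 0` that satisfy the interpolation conditions. -/
def Data.functionClass (D : Data K) : Set (Lifted K) :=
  {Z | (Z.1 : Matrix (Fin (K + 2)) (Fin (K + 2)) ℝ).PosSemidef ∧ ∀ m, 0 ≤ D.S Z m}

/-- The set `𝒳` of pairs `(G, F)` with `G ⪰ 0` that satisfy the initial condition. -/
def Data.initialSet (D : Data K) : Set (Lifted K) :=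
  {Z | (Z.1 : Matrix (Fin (K + 2)) (Fin (K + 2)) ℝ).PosSemidef ∧ pairing D.init Z + D.c₀ ≤ 0}

/-- The performance metric as a function of `Z = (G, F)`. -/
def Data.perf (D : Data K) (Z : Lifted K) : ℝ := pairing D.obj Z

/-- The norm dual to `nrm` with respect to the pairing. -/
def dualNorm (nrm : Seminorm ℝ (Lifted K)) (W : Lifted K) : ℝ :=
  sSup {r : ℝ | ∃ Z : Lifted K, nrm Z ≤ 1 ∧ r = pairing W Z}

/-- The cone `{(P, 0) : P ⪰ 0}`. -/
def psdCone (K : ℕ) : Set (Lifted K) :=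
  {W | (W.1 : Matrix (Fin (K + 2)) (Fin (K + 2)) ℝ).PosSemidef ∧ W.2 = 0}

/-- The variables of the distributionally robust problem with `N` samples and `J` loss pieces. -/
structure Vars (K N J : ℕ) where
  s : Fin N → ℝ
  t : ℝ
  lam : ℝ
  τ : Fin N → Fin J → ℝ
  XY : Fin N → Fin J → Lifted K
  y : Fin N → Fin J → PairIdx K → ℝ

/-- Feasibility for the distributionally robust problem, whose loss is the maximum over `j` of
`⟨L j, Z⟩ + c j * t`. -/
structure Vars.Feasible {N J : ℕ} (v : Vars K N J) (D : Data K) (nrm : Seminorm ℝ (Lifted K))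
    (Zhat : Fin N → Lifted K) (L : Fin J → Lifted K) (c : Fin J → ℝ) (ε : ℝ) : Prop where
  lam_nonneg : 0 ≤ v.lam
  τ_nonneg : ∀ i j, 0 ≤ v.τ i j
  y_nonneg : ∀ i j m, 0 ≤ v.y i j m
  epigraph : ∀ i j,
    c j * v.t - D.c₀ * v.τ i j - pairing (v.XY i j) (Zhat i) + v.lam * ε ≤ v.s i
  conic : ∀ i j, - D.adjS (v.y i j) - v.XY i j + v.τ i j • D.init - L j ∈ psdCone K
  norm_le : ∀ i j, dualNorm nrm (v.XY i j) ≤ v.lam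

/-- The optimal value of the distributionally robust problem (minimization of `(1/N) ∑ i, s_i`). -/
def value {N J : ℕ} (D : Data K) (nrm : Seminorm ℝ (Lifted K))
    (Zhat : Fin N → Lifted K) (L : Fin J → Lifted K) (c : Fin J → ℝ) (ε : ℝ) : EReal :=
  ⨅ (v : Vars K N J) (_ : v.Feasible D nrm Zhat L c ε),
    (((1 / (N : ℝ)) * ∑ i, v.s i : ℝ) : EReal)

/-- The expectation case: `J = 1` with the performance metric itself as the only loss. -/
def expectationValue {N : ℕ} (D : Data K) (nrm : Seminorm ℝ (Lifted K))
    (Zhat : Fin N → Lifted K) (ε : ℝ) : EReal :=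
  value D nrm Zhat ![D.obj] ![0] ε

/-- The conditional value-at-risk case: `J = 2` with the pieces
`α⁻¹ ⟨(A_obj, b_obj), Z⟩ + (1 - α⁻¹) t` and `t`. -/
def cvarValue {N : ℕ} (D : Data K) (nrm : Seminorm ℝ (Lifted K))
    (Zhat : Fin N → Lifted K) (α ε : ℝ) : EReal :=
  value D nrm Zhat ![α⁻¹ • D.obj, 0] ![1 - α⁻¹, 1] ε

/-- The in-sample average of the performance metric. -/
def sampleAverage {N : ℕ} (D : Data K) (Zhat : Fin N → Lifted K) : ℝ :=
  (1 / (N : ℝ)) * ∑ i, D.perf (Zhat i)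

/-- The in-sample conditional value-at-risk
`inf_t (t + (α⁻¹ / N) ∑ i, (perf (Zhat i) - t)₊)`. -/
def sampleCVaR {N : ℕ} (D : Data K) (Zhat : Fin N → Lifted K) (α : ℝ) : EReal :=
  ⨅ t : ℝ, ((t + (α⁻¹ / (N : ℝ)) * ∑ i, max (D.perf (Zhat i) - t) 0 : ℝ) : EReal)

/-- The optimal value of: maximize `(α⁻¹ / N) ∑ i, a_i * perf (Zhat i)` over `a ∈ [0, 1]^N` with
`(1/N) ∑ i, a_i = α`. -/
def sampleCVaRWeights {N : ℕ} (D : Data K) (Zhat : Fin N → Lifted K) (α : ℝ) : EReal :=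
  ⨆ (a : Fin N → ℝ) (_ : (∀ i, a i ∈ Set.Icc (0 : ℝ) 1) ∧ (1 / (N : ℝ)) * ∑ i, a i = α),
    (((α⁻¹ / (N : ℝ)) * ∑ i, a i * D.perf (Zhat i) : ℝ) : EReal)

/-- The worst-case performance over `ℱ ∩ 𝒳`. -/
def worstCase (D : Data K) : EReal :=
  ⨆ Z ∈ D.functionClass ∩ D.initialSet, (D.perf Z : EReal)

/-- The optimal value of the dual of the worst-case performance estimation problem: minimize
`- c₀ τ` over `τ ≥ 0` and `y ≥ 0` with `- 𝒮* (y) + τ (A₀, b₀) - (A_obj, b_obj)` in the cone. -/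
def worstCaseDual (D : Data K) : EReal :=
  ⨅ (τ : ℝ) (y : PairIdx K → ℝ)
    (_ : 0 ≤ τ ∧ (∀ m, 0 ≤ y m) ∧ - D.adjS y + τ • D.init - D.obj ∈ psdCone K),
    ((- D.c₀ * τ : ℝ) : EReal)

end DroPep

end

/-! The optimal value is sandwiched between one weak duality inequality and two explicit feasible
points. Pairing the conic constraint with a feasible `Z` and using the dual norm bound shows that `s
i` dominates each loss piece at every feasible `Z` within `ε` of sample `i`
(`Vars.Feasible.loss_le`). Taking `Z` to be the sample gives the in-sample lower bound; once `ε`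
covers the compact feasible set, every `Z` is admitted and the worst case is a lower bound.
Conversely, `XY = -L` with zero multipliers costs the in-sample loss plus a constant times `ε`
(`value_le_add`), and `XY = 0`, `lam = 0` with worst-case multipliers costs a bound free of `ε`
(`value_le_of_certificates`).

For large `ε` the bounds meet by strong duality, with compactness in place of a Slater condition. If
`(D.obj, r)` lies outside the certificate cone, a separating functional is a nonzero pair `(Z, z)`
obeying the homogenized constraints: `z > 0` gives a feasible `z⁻¹ • Z` with performance at least
`r`, and `z = 0` a nonzero recession direction. The weight formula for the in-sample CVaR is
fractional knapsack duality: optimal weights fill the largest values down to a quantile. -/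

/-- A point outside a convex set containing the origin is weakly separated from it by a nonzero
linear functional; the set need not be closed. -/
theorem exists_ne_zero_forall_le_of_notMem {V : Type*} [AddCommGroup V] [Module ℝ V]
    [FiniteDimensional ℝ V] {s : Set V} (hs : Convex ℝ s) (h0 : (0 : V) ∈ s) {x : V}
    (hx : x ∉ s) : ∃ f : V →ₗ[ℝ] ℝ, f ≠ 0 ∧ ∀ d ∈ s, f x ≤ f d := by
  by_cases hspan : Submodule.span ℝ s = ⊤
  -- Coordinates supply a topology. Since `0 ∈ s`, full linear span means full affine span, hence
  -- nonempty interior, and no closedness is needed to separate.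
  · let e : V ≃ₗ[ℝ] (Fin (Module.finrank ℝ V) → ℝ) := (Module.finBasis ℝ V).equivFun
    have hconv : Convex ℝ (e '' s) := hs.linear_image e.toLinearMap
    have h0' : (0 : Fin (Module.finrank ℝ V) → ℝ) ∈ e '' s := ⟨0, h0, map_zero e⟩
    have hint : (interior (e '' s)).Nonempty := by
      rw [hconv.interior_nonempty_iff_affineSpan_eq_top, ← Set.insert_eq_of_mem h0']
      have : Submodule.span ℝ (e '' s) = ⊤ := by
        have := Submodule.map_span e.toLinearMap s
        rw [hspan, Submodule.map_top, LinearEquiv.range] at this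
        exact this.symm
      refine SetLike.coe_injective ?_
      rw [affineSpan_insert_zero, this]
      rfl
    have hxe : e x ∉ interior (e '' s) := fun h => by
      obtain ⟨z, hz, hzx⟩ := interior_subset h
      exact hx (e.injective hzx ▸ hz)
    obtain ⟨f, u, hf, hA, hB⟩ := geometric_hahn_banach_of_nonempty_interior hconv
      (convex_singleton (e x)) (Set.disjoint_singleton_right.2 hxe) hint (Set.singleton_nonempty _)
    refine ⟨-(f.toLinearMap ∘ₗ e.toLinearMap), fun h => hf ?_, fun d hd => ?_⟩
    · ext1 w
      have := LinearMap.congr_fun h (e.symm w)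
      simpa using this
    · have h1 := hA (e d) ⟨d, hd, rfl⟩
      have h2 := hB (e x) rfl
      simpa using h1.trans h2
  · obtain ⟨f, hf, hle⟩ := Submodule.exists_le_ker_of_lt_top _ (lt_top_iff_ne_top.2 hspan)
    have hz : ∀ d ∈ s, f d = 0 := fun d hd => hle (Submodule.subset_span hd)
    rcases le_total (f x) 0 with h | h
    · exact ⟨f, hf, fun d hd => by rw [hz d hd]; exact h⟩
    · exact ⟨-f, neg_ne_zero.2 hf, fun d hd => by simpa [hz d hd] using h⟩

/-- A linear functional on a finite-dimensional space is bounded with respect to any norm. -/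
theorem LinearMap.exists_abs_le_mul_seminorm {V : Type*} [AddCommGroup V] [Module ℝ V]
    [FiniteDimensional ℝ V] (p : Seminorm ℝ V) (hp : ∀ x, p x = 0 → x = 0) (f : V →ₗ[ℝ] ℝ) :
    ∃ C, ∀ x, |f x| ≤ C * p x := by
  let : NormedAddCommGroup V :=
    { p.toAddGroupSeminorm with eq_zero_of_map_eq_zero' := hp : AddGroupNorm V }.toNormedAddCommGroup
  let : NormedSpace ℝ V := ⟨fun a x => (map_smul_eq_mul p a x).le⟩
  exact ⟨_, (LinearMap.toContinuousLinearMap f).le_opNorm⟩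

/-- A seminorm is bounded on compact subsets of a finite-dimensional space. -/
theorem Seminorm.exists_forall_le_of_isCompact {V : Type*} [AddCommGroup V] [Module ℝ V]
    [FiniteDimensional ℝ V] [TopologicalSpace V] [IsTopologicalAddGroup V] [ContinuousSMul ℝ V]
    [T2Space V] (p : Seminorm ℝ V) {s : Set V} (hs : IsCompact s) : ∃ C, ∀ x ∈ s, p x ≤ C := by
  let b := Module.finBasis ℝ V
  have hcont : Continuous fun x => ∑ i, |b.coord i x| * p (b i) :=
    _root_.continuous_finsetSum _ fun i _ =>
      ((b.coord i).continuous_of_finiteDimensional.abs).mul continuous_const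
  obtain ⟨C, hC⟩ := (hs.image hcont).bddAbove
  refine ⟨C, fun x hx => le_trans ?_ (hC ⟨x, hx, rfl⟩)⟩
  calc p x = p (∑ i, b.repr x i • b i) := by rw [b.sum_repr]
    _ ≤ ∑ i, p (b.repr x i • b i) := 
        Finset.le_sum_of_subadditive p (map_zero p).le (map_add_le_add p) _ _
    _ = _ := by simp [map_smul_eq_mul]

/-- Two real matrices that are positive semidefinite have a product of nonnegative trace. -/
theorem Matrix.PosSemidef.trace_mul_nonneg_real {n : Type*} [Fintype n] {A B : Matrix n n ℝ}
    (hA : A.PosSemidef) (hB : B.PosSemidef) : 0 ≤ (A * B).trace := by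
  obtain ⟨m, v, rfl⟩ := Matrix.posSemidef_iff_eq_sum_vecMulVec.1 hA
  rw [Matrix.sum_mul, Matrix.trace_sum]
  refine Finset.sum_nonneg fun i _ => ?_
  rw [Matrix.vecMulVec_mul, Matrix.trace_vecMulVec]
  have := hB.dotProduct_mulVec_nonneg (v i)
  simpa [Matrix.dotProduct_mulVec, dotProduct_comm] using this

/-! ### The pairing and self-duality of the semidefinite cone -/

namespace DroPep

variable {K : ℕ}

theorem pairing_add_left (W W' Z : Lifted K) :
    pairing (W + W') Z = pairing W Z + pairing W' Z := by
  simp [pairing, add_mul]; ring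

theorem pairing_smul_left (c : ℝ) (W Z : Lifted K) : pairing (c • W) Z = c * pairing W Z := by
  simp [pairing]; ring

theorem pairing_comm (W Z : Lifted K) : pairing W Z = pairing Z W := by
  unfold pairing
  rw [dotProduct_comm, ← Matrix.trace_transpose, Matrix.transpose_mul, Matrix.transpose_transpose]

/-- The pairing as a bilinear map. -/
def pairingLin (K : ℕ) : Lifted K →ₗ[ℝ] Lifted K →ₗ[ℝ] ℝ :=
  LinearMap.mk₂ ℝ pairing pairing_add_left pairing_smul_left
    (fun W Z Z' => by simp only [pairing_comm W, pairing_add_left])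
    (fun c W Z => by simp only [pairing_comm W, pairing_smul_left, smul_eq_mul])

@[simp]
theorem pairingLin_apply (W Z : Lifted K) : pairingLin K W Z = pairing W Z := rfl

theorem pairing_neg_left (W Z : Lifted K) : pairing (-W) Z = -pairing W Z := by
  simp [← pairingLin_apply]

theorem pairing_sub_left (W W' Z : Lifted K) :
    pairing (W - W') Z = pairing W Z - pairing W' Z := by
  simp [← pairingLin_apply]

theorem pairing_zero_left (Z : Lifted K) : pairing 0 Z = 0 := by
  simp [← pairingLin_apply]

theorem pairing_add_right (W Z Z' : Lifted K) :
    pairing W (Z + Z') = pairing W Z + pairing W Z' := by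
  simp [← pairingLin_apply]

theorem pairing_smul_right (c : ℝ) (W Z : Lifted K) : pairing W (c • Z) = c * pairing W Z := by
  simp [← pairingLin_apply]

theorem pairing_neg_right (W Z : Lifted K) : pairing W (-Z) = -pairing W Z := by
  simp [← pairingLin_apply]

theorem pairing_sub_right (W Z Z' : Lifted K) :
    pairing W (Z - Z') = pairing W Z - pairing W Z' := by
  simp [← pairingLin_apply]

theorem eq_zero_of_pairing_self_nonpos {Z : Lifted K} (h : pairing Z Z ≤ 0) : Z = 0 := by
  unfold pairing at h
  have h1 : 0 ≤ ((Z.1 : Matrix (Fin (K + 2)) (Fin (K + 2)) ℝ).transpose * Z.1.1).trace := by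
    have := (Matrix.posSemidef_conjTranspose_mul_self Z.1.1).trace_nonneg
    rwa [Matrix.conjTranspose_eq_transpose_of_trivial] at this
  have h2 : 0 ≤ Z.2 ⬝ᵥ Z.2 := Finset.sum_nonneg fun i _ => mul_self_nonneg _
  have h3 : Z.1.1 = 0 := by
    have h4 := Matrix.trace_conjTranspose_mul_self_eq_zero_iff (R := ℝ) (A := Z.1.1)
    rw [Matrix.conjTranspose_eq_transpose_of_trivial] at h4
    exact h4.1 (by linarith)
  exact Prod.ext (Subtype.ext h3) (dotProduct_self_eq_zero.1 (by linarith))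

/-- Every linear functional on the lifted space is the pairing with some element. -/
theorem exists_eq_pairing (f : Lifted K →ₗ[ℝ] ℝ) : ∃ Z, ∀ W, f W = pairing W Z := by
  have hinj : Function.Injective (pairingLin K) := by
    rw [← LinearMap.ker_eq_bot, LinearMap.ker_eq_bot']
    intro Z hZ
    exact eq_zero_of_pairing_self_nonpos (LinearMap.congr_fun hZ Z).le
  obtain ⟨Z, hZ⟩ := (LinearMap.injective_iff_surjective_of_finrank_eq_finrank
    (Subspace.dual_finrank_eq (K := ℝ) (V := Lifted K)).symm).1 hinj f
  exact ⟨Z, fun W => by rw [← hZ, pairingLin_apply, pairing_comm]⟩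

theorem pairing_nonneg_of_mem_psdCone {W Z : Lifted K} (hW : W ∈ psdCone K)
    (hZ : (Z.1 : Matrix (Fin (K + 2)) (Fin (K + 2)) ℝ).PosSemidef) : 0 ≤ pairing W Z := by
  rw [pairing, hW.2, zero_dotProduct, add_zero]
  exact hW.1.transpose.trace_mul_nonneg_real hZ

/-- Testing against the rank-one matrices `x xᵀ` recovers the quadratic form of `Z.1`. -/
theorem posSemidef_of_forall_pairing_nonneg {Z : Lifted K}
    (h : ∀ W ∈ psdCone K, 0 ≤ pairing W Z) :
    (Z.1 : Matrix (Fin (K + 2)) (Fin (K + 2)) ℝ).PosSemidef := by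
  refine Matrix.PosSemidef.of_dotProduct_mulVec_nonneg ?_ fun x => ?_
  · rw [Matrix.IsHermitian, Matrix.conjTranspose_eq_transpose_of_trivial]
    exact Z.1.2
  · have hP := Matrix.posSemidef_vecMulVec_self_star x
    rw [star_trivial] at hP ⊢
    have := h (⟨Matrix.vecMulVec x x, Matrix.transpose_vecMulVec x x⟩, 0) ⟨hP, rfl⟩
    simpa [pairing, Matrix.transpose_vecMulVec, Matrix.vecMulVec_mul, Matrix.trace_vecMulVec,
      Matrix.dotProduct_mulVec, dotProduct_comm] using this

theorem zero_mem_psdCone : (0 : Lifted K) ∈ psdCone K := ⟨Matrix.PosSemidef.zero, rfl⟩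

theorem add_mem_psdCone {W W' : Lifted K} (h : W ∈ psdCone K) (h' : W' ∈ psdCone K) :
    W + W' ∈ psdCone K :=
  ⟨h.1.add h'.1, by simp [h.2, h'.2]⟩

theorem smul_mem_psdCone {W : Lifted K} (h : W ∈ psdCone K) {c : ℝ} (hc : 0 ≤ c) :
    c • W ∈ psdCone K :=
  ⟨h.1.smul hc, by simp [h.2]⟩

theorem Data.adjS_add (D : Data K) (y y' : PairIdx K → ℝ) :
    D.adjS (y + y') = D.adjS y + D.adjS y' := by
  simp only [Data.adjS, Pi.add_apply, add_smul, Finset.sum_add_distrib, neg_add]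

theorem Data.adjS_smul (D : Data K) (c : ℝ) (y : PairIdx K → ℝ) :
    D.adjS (c • y) = c • D.adjS y := by
  simp [Data.adjS, mul_smul, Finset.smul_sum]

theorem Data.adjS_zero (D : Data K) : D.adjS 0 = 0 := by simp [Data.adjS]

theorem Data.adjS_single (D : Data K) (m : PairIdx K) :
    D.adjS (Pi.single m 1) = -D.interp m := by
  simp [Data.adjS, Pi.single_apply, ite_smul]

theorem Data.pairing_adjS (D : Data K) (y : PairIdx K → ℝ) (Z : Lifted K) :
    pairing (D.adjS y) Z = ∑ m, y m * D.S Z m := by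
  simp [Data.adjS, Data.S, ← pairingLin_apply]

/-! ### Strong duality for the worst-case problem -/

/-- The right-hand sides `(W, w)` for which the linear form `⟨W, ·⟩` is certified to be at most `w`
on the feasible set by dual multipliers. -/
def Data.certificateCone (D : Data K) : Set (Lifted K × ℝ) :=
  {p | ∃ (τ : ℝ) (y : PairIdx K → ℝ), 0 ≤ τ ∧ (∀ m, 0 ≤ y m) ∧
    -D.adjS y + τ • D.init - p.1 ∈ psdCone K ∧ -D.c₀ * τ ≤ p.2}

theorem Data.zero_mem_certificateCone (D : Data K) : 0 ∈ D.certificateCone :=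
  ⟨0, 0, le_rfl, fun _ => le_rfl, by simpa [Data.adjS_zero] using zero_mem_psdCone, by simp⟩

theorem Data.smul_mem_certificateCone (D : Data K) {p : Lifted K × ℝ}
    (hp : p ∈ D.certificateCone) {c : ℝ} (hc : 0 ≤ c) : c • p ∈ D.certificateCone := by
  obtain ⟨τ, y, hτ, hy, hmem, hle⟩ := hp
  refine ⟨c * τ, c • y, mul_nonneg hc hτ, fun m => mul_nonneg hc (hy m), ?_, ?_⟩
  · convert smul_mem_psdCone hmem hc using 1
    rw [Data.adjS_smul, Prod.smul_fst]
    module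
  · have := mul_le_mul_of_nonneg_left hle hc
    rw [Prod.smul_snd, smul_eq_mul]
    linarith

theorem Data.add_mem_certificateCone (D : Data K) {p q : Lifted K × ℝ}
    (hp : p ∈ D.certificateCone) (hq : q ∈ D.certificateCone) : p + q ∈ D.certificateCone := by
  obtain ⟨τ, y, hτ, hy, hmem, hle⟩ := hp
  obtain ⟨τ', y', hτ', hy', hmem', hle'⟩ := hq
  refine ⟨τ + τ', y + y', add_nonneg hτ hτ', fun m => add_nonneg (hy m) (hy' m), ?_, ?_⟩
  · convert add_mem_psdCone hmem hmem' using 1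
    rw [Data.adjS_add, Prod.fst_add]
    module
  · rw [Prod.snd_add]
    linarith

theorem Data.convex_certificateCone (D : Data K) : Convex ℝ D.certificateCone :=
  fun _ hp _ hq _ _ ha hb _ =>
    D.add_mem_certificateCone (D.smul_mem_certificateCone hp ha) (D.smul_mem_certificateCone hq hb)

/-- If the feasible set is compact and contains a point, then a strict upper bound of the
performance metric has a dual certificate. -/
theorem Data.mem_certificateCone_of_forall_lt (D : Data K)
    (hcomp : IsCompact (D.functionClass ∩ D.initialSet)) {Z₀ : Lifted K}
    (hZ₀ : Z₀ ∈ D.functionClass ∩ D.initialSet) {r : ℝ}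
    (hr : ∀ Z ∈ D.functionClass ∩ D.initialSet, D.perf Z < r) :
    (D.obj, r) ∈ D.certificateCone := by
  by_contra hnot
  obtain ⟨f, hf, hsep⟩ := exists_ne_zero_forall_le_of_notMem D.convex_certificateCone
    D.zero_mem_certificateCone hnot
  have hx : f (D.obj, r) ≤ 0 := by simpa using hsep 0 D.zero_mem_certificateCone
  have hpos : ∀ d ∈ D.certificateCone, 0 ≤ f d := by
    intro d hd
    by_contra! hneg
    -- The multiple of `d` is chosen so that `f` takes the value `f (D.obj, r) - 1` on it, below the
    -- separation bound.
    have h1 := hsep _ (D.smul_mem_certificateCone hd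
      (c := (f (D.obj, r) - 1) / f d) (div_nonneg_of_nonpos (by linarith) hneg.le))
    rw [map_smul, smul_eq_mul, div_mul_cancel₀ _ hneg.ne] at h1
    linarith
  -- The sign of `Z` is chosen so that `f (W, w) = w * z - pairing W Z`; evaluating `f` on
  -- generators of the cone then gives the homogenized primal constraints.
  obtain ⟨Z', hZ'⟩ := exists_eq_pairing (f ∘ₗ LinearMap.inl ℝ (Lifted K) ℝ)
  obtain ⟨Z, rfl⟩ : ∃ Z, Z' = -Z := ⟨-Z', (neg_neg _).symm⟩
  set z : ℝ := f (0, 1) with hz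
  have hfeq : ∀ W w, f (W, w) = w * z - pairing W Z := by
    intro W w
    have h1 : f (W, 0) = -pairing W Z := by simpa [pairing_neg_right] using hZ' W
    have h2 : ((W, w) : Lifted K × ℝ) = (W, 0) + w • (0, 1) := by simp
    rw [h2, map_add, map_smul, h1, ← hz, smul_eq_mul]
    ring
  have hz0 : 0 ≤ z := hpos _
    ⟨0, 0, le_rfl, fun _ => le_rfl, by simpa [Data.adjS_zero] using zero_mem_psdCone, by simp⟩
  have hpsd : (Z.1 : Matrix (Fin (K + 2)) (Fin (K + 2)) ℝ).PosSemidef := by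
    refine posSemidef_of_forall_pairing_nonneg fun W hW => ?_
    have := hpos (-W, 0)
      ⟨0, 0, le_rfl, fun _ => le_rfl, by simpa [Data.adjS_zero] using hW, by simp⟩
    rw [hfeq, pairing_neg_left] at this
    linarith
  have hinterp : ∀ m, pairing (D.interp m) Z ≤ 0 := by
    intro m
    have := hpos (D.interp m, 0) ⟨0, Pi.single m 1, le_rfl,
      fun m' => by by_cases h : m' = m <;> simp [h], by
        simpa [Data.adjS_single] using zero_mem_psdCone, by simp⟩
    rw [hfeq] at this
    linarith
  have hinit : pairing D.init Z + z * D.c₀ ≤ 0 := by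
    have := hpos (D.init, -D.c₀) ⟨1, 0, zero_le_one, fun _ => le_rfl, by
      simpa [Data.adjS_zero] using zero_mem_psdCone, by simp⟩
    rw [hfeq] at this
    linarith
  rw [hfeq] at hx
  rcases hz0.eq_or_lt with hz1 | hz1
  -- With `z = 0`, `Z` is a recession direction of the feasible set, nonzero because `f ≠ 0`;
  -- `pairing Z` is then unbounded along the ray from `Z₀`.
  · have hray : ∀ k : ℝ, 0 ≤ k → Z₀ + k • Z ∈ D.functionClass ∩ D.initialSet := by
      intro k hk
      have hG : ((Z₀ + k • Z).1 : Matrix (Fin (K + 2)) (Fin (K + 2)) ℝ).PosSemidef :=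
        hZ₀.1.1.add (hpsd.smul hk)
      refine ⟨⟨hG, fun m => ?_⟩, hG, ?_⟩
      · have h1 := hZ₀.1.2 m
        have h2 := mul_nonneg hk (neg_nonneg.2 (hinterp m))
        simp only [Data.S, pairing_add_right, pairing_smul_right] at h1 ⊢
        linarith
      · have h1 := hZ₀.2.2
        have h2 := mul_nonneg hk (neg_nonneg.2 hinit)
        rw [← hz1] at h2
        rw [pairing_add_right, pairing_smul_right]
        linarith
    have hZne : 0 < pairing Z Z := by
      by_contra! hle
      have hZ0 := eq_zero_of_pairing_self_nonpos hle
      refine hf (LinearMap.ext fun p => ?_)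
      rw [← Prod.mk.eta (p := p), hfeq, hZ0, ← hz1, pairing_comm, pairing_zero_left]
      simp
    obtain ⟨B, hB⟩ := (hcomp.image
      (pairingLin K Z).continuous_of_finiteDimensional).bddAbove
    have h1 := hB ⟨_, hray ((|B - pairing Z Z₀| + 1) / pairing Z Z) (by positivity), rfl⟩
    rw [pairingLin_apply, pairing_add_right, pairing_smul_right, div_mul_cancel₀ _ hZne.ne'] at h1
    linarith [le_abs_self (B - pairing Z Z₀)]
  · have hzi : 0 ≤ z⁻¹ := inv_nonneg.2 hz0
    have hG : ((z⁻¹ • Z).1 : Matrix (Fin (K + 2)) (Fin (K + 2)) ℝ).PosSemidef := hpsd.smul hzi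
    have hmem : z⁻¹ • Z ∈ D.functionClass ∩ D.initialSet := by
      refine ⟨⟨hG, fun m => ?_⟩, hG, ?_⟩
      · simp only [Data.S, pairing_smul_right]
        have := mul_nonneg hzi (neg_nonneg.2 (hinterp m))
        linarith
      · have := mul_nonneg hzi (neg_nonneg.2 hinit)
        rw [pairing_smul_right]
        have h3 : z⁻¹ * (z * D.c₀) = D.c₀ := by field_simp
        linarith
    have h1 := hr _ hmem
    rw [Data.perf, pairing_smul_right, inv_mul_lt_iff₀ hz1] at h1
    linarith

theorem Data.pairing_le_of_dual_feasible (D : Data K) {τ : ℝ} {y : PairIdx K → ℝ} {W Z : Lifted K}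
    (hτ : 0 ≤ τ) (hy : ∀ m, 0 ≤ y m) (hmem : -D.adjS y + τ • D.init - W ∈ psdCone K)
    (hZ : Z ∈ D.functionClass ∩ D.initialSet) : pairing W Z ≤ -D.c₀ * τ := by
  have h1 := pairing_nonneg_of_mem_psdCone hmem hZ.1.1
  rw [pairing_sub_left, pairing_add_left, pairing_neg_left, pairing_smul_left,
    Data.pairing_adjS] at h1
  have h2 : 0 ≤ ∑ m, y m * D.S Z m := Finset.sum_nonneg fun m _ => mul_nonneg (hy m) (hZ.1.2 m)
  have h3 := mul_nonneg hτ (neg_nonneg.2 hZ.2.2)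
  linarith

/-- Strong duality for the worst-case problem. -/
theorem worstCase_eq_worstCaseDual (D : Data K)
    (hcomp : IsCompact (D.functionClass ∩ D.initialSet)) {Z₀ : Lifted K}
    (hZ₀ : Z₀ ∈ D.functionClass ∩ D.initialSet) : worstCase D = worstCaseDual D := by
  refine le_antisymm ?_ (EReal.le_of_forall_lt_iff_le.1 fun r hr => ?_)
  · refine iSup₂_le fun Z hZ => le_iInf fun τ => le_iInf fun y => le_iInf fun h => ?_
    exact EReal.coe_le_coe_iff.2 (D.pairing_le_of_dual_feasible h.1 h.2.1 h.2.2 hZ)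
  · obtain ⟨τ, y, hτ, hy, hmem, hle⟩ := D.mem_certificateCone_of_forall_lt hcomp hZ₀ (r := r)
      fun Z hZ => EReal.coe_lt_coe_iff.1
        ((le_iSup₂ (f := fun Z _ => (D.perf Z : EReal)) Z hZ).trans_lt hr)
    exact iInf_le_of_le τ (iInf_le_of_le y (iInf_le_of_le ⟨hτ, hy, hmem⟩
      (EReal.coe_le_coe_iff.2 hle)))

/-! ### The dual norm -/

theorem pairing_le_dualNorm_mul (nrm : Seminorm ℝ (Lifted K)) (hnrm : ∀ Z, nrm Z = 0 → Z = 0)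
    (W Z : Lifted K) : pairing W Z ≤ dualNorm nrm W * nrm Z := by
  rcases (apply_nonneg nrm Z).eq_or_lt with h | h
  · rw [hnrm Z h.symm, pairing_comm, pairing_zero_left, map_zero, mul_zero]
  -- Boundedness is essential: the real `sSup` of an unbounded set is `0`.
  · have hbdd : BddAbove {r : ℝ | ∃ Z : Lifted K, nrm Z ≤ 1 ∧ r = pairing W Z} := by
      obtain ⟨C, hC⟩ := LinearMap.exists_abs_le_mul_seminorm nrm hnrm (pairingLin K W)
      refine ⟨|C|, ?_⟩
      rintro _ ⟨Z', hZ', rfl⟩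
      calc pairing W Z' ≤ C * nrm Z' := (le_abs_self _).trans (hC Z')
        _ ≤ |C| * 1 := mul_le_mul (le_abs_self C) hZ' (apply_nonneg nrm Z') (abs_nonneg C)
        _ = |C| := mul_one _
    have h1 : pairing W ((nrm Z)⁻¹ • Z) ≤ dualNorm nrm W := by
      refine le_csSup hbdd ⟨_, ?_, rfl⟩
      rw [map_smul_eq_mul, Real.norm_of_nonneg (inv_nonneg.2 h.le), inv_mul_cancel₀ h.ne']
    rwa [pairing_smul_right, inv_mul_le_iff₀ h, mul_comm] at h1

theorem dualNorm_zero (nrm : Seminorm ℝ (Lifted K)) : dualNorm nrm 0 = 0 := by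
  have : {r : ℝ | ∃ Z : Lifted K, nrm Z ≤ 1 ∧ r = pairing 0 Z} = {0} := by
    ext r
    simp only [pairing_zero_left, Set.mem_ofPred_eq, Set.mem_singleton_iff]
    exact ⟨fun ⟨_, _, h⟩ => h, fun h => ⟨0, by simp, h⟩⟩
  rw [dualNorm, this, csSup_singleton]

theorem dualNorm_nonneg (nrm : Seminorm ℝ (Lifted K)) (hnrm : ∀ Z, nrm Z = 0 → Z = 0)
    (W : Lifted K) : 0 ≤ dualNorm nrm W := by
  by_cases h : W = 0
  · rw [h, dualNorm_zero]
  · have h1 : 0 < nrm W := (apply_nonneg nrm W).lt_of_ne fun h0 => h (hnrm W h0.symm)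
    have h2 : 0 < pairing W W := by
      by_contra! h3
      exact h (eq_zero_of_pairing_self_nonpos h3)
    exact (pos_of_mul_pos_left (h2.trans_le (pairing_le_dualNorm_mul nrm hnrm W W)) h1.le).le

/-! ### Lower and upper bounds for the robust value -/

section

variable {N J : ℕ} {D : Data K} {nrm : Seminorm ℝ (Lifted K)} {Zhat : Fin N → Lifted K}
  {L : Fin J → Lifted K} {c : Fin J → ℝ} {ε : ℝ}

/-- Weak duality: the epigraph variable of a sample dominates every loss piece on the feasible
points within distance `ε` of the sample. -/
theorem Vars.Feasible.loss_le {v : Vars K N J} (hv : v.Feasible D nrm Zhat L c ε)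
    (hnrm : ∀ Z, nrm Z = 0 → Z = 0) {Z : Lifted K} (hZ : Z ∈ D.functionClass ∩ D.initialSet)
    (i : Fin N) (hdist : nrm (Zhat i - Z) ≤ ε) (j : Fin J) :
    c j * v.t + pairing (L j) Z ≤ v.s i := by
  have h1 := D.pairing_le_of_dual_feasible (W := v.XY i j + L j) (hv.τ_nonneg i j)
    (hv.y_nonneg i j) (by convert hv.conic i j using 1; module) hZ
  have h2 : pairing (v.XY i j) (Zhat i - Z) ≤ v.lam * ε :=
    (pairing_le_dualNorm_mul nrm hnrm _ _).trans
      (mul_le_mul (hv.norm_le i j) hdist (apply_nonneg nrm _) hv.lam_nonneg)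
  have h3 := hv.epigraph i j
  rw [pairing_sub_right] at h2
  rw [pairing_add_left] at h1
  linarith

theorem le_value {r : EReal} (h : ∀ v : Vars K N J, v.Feasible D nrm Zhat L c ε →
    r ≤ (((1 / (N : ℝ)) * ∑ i, v.s i : ℝ) : EReal)) : r ≤ value D nrm Zhat L c ε :=
  le_iInf₂ h

/-- The optimal value is at most the in-sample average loss plus a multiple of the radius. -/
theorem value_le_add (hN : 0 < N) (hnrm : ∀ Z, nrm Z = 0 → Z = 0) (t : ℝ) {s : Fin N → ℝ}
    (hs : ∀ i j, c j * t + pairing (L j) (Zhat i) ≤ s i) :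
    value D nrm Zhat L c ε ≤
      (((1 / (N : ℝ)) * ∑ i, s i + (∑ j, dualNorm nrm (-L j)) * ε : ℝ) : EReal) := by
  have hnn : ∀ j ∈ Finset.univ, 0 ≤ dualNorm nrm (-L j) := fun j _ => dualNorm_nonneg nrm hnrm _
  -- `XY = -L` makes the conic slack zero; the sum of the dual norms is one `lam` that serves every
  -- piece.
  refine (iInf₂_le
    { s := fun i => s i + (∑ j, dualNorm nrm (-L j)) * ε
      t := t
      lam := ∑ j, dualNorm nrm (-L j)
      τ := 0
      XY := fun _ j => -L j
      y := 0 } ?_).trans ?_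
  · constructor
    · exact Finset.sum_nonneg hnn
    · exact fun _ _ => le_rfl
    · exact fun _ _ _ => le_rfl
    · intro i j
      have := hs i j
      simp only [Pi.zero_apply, mul_zero, pairing_neg_left]
      linarith
    · intro i j
      simpa [Data.adjS_zero] using zero_mem_psdCone
    · exact fun i j => Finset.single_le_sum hnn (Finset.mem_univ j)
  · refine EReal.coe_le_coe_iff.2 (le_of_eq ?_)
    have : (N : ℝ) ≠ 0 := by positivity
    simp only [Finset.sum_add_distrib, Finset.sum_const, Finset.card_univ, Fintype.card_fin,
      nsmul_eq_mul]
    field_simp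

/-- Dual multipliers that certify a common bound `r` on all loss pieces bound the optimal value,
whatever the radius is. -/
theorem value_le_of_certificates (hN : 0 < N) (t r : ℝ) (τ : Fin J → ℝ)
    (y : Fin J → PairIdx K → ℝ) (hτ : ∀ j, 0 ≤ τ j) (hy : ∀ j m, 0 ≤ y j m)
    (hmem : ∀ j, -D.adjS (y j) + τ j • D.init - L j ∈ psdCone K)
    (hr : ∀ j, c j * t - D.c₀ * τ j ≤ r) : value D nrm Zhat L c ε ≤ (r : EReal) := by
  refine (iInf₂_le
    { s := fun _ => r, t := t, lam := 0, τ := fun _ => τ, XY := 0, y := fun _ => y } ?_).trans ?_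
  · constructor
    · exact le_rfl
    · exact fun _ => hτ
    · exact fun _ => hy
    · intro i j
      simpa [pairing_zero_left] using hr j
    · intro i j
      simpa using hmem j
    · intro i j
      simp [dualNorm_zero]
  · refine EReal.coe_le_coe_iff.2 (le_of_eq ?_)
    have : (N : ℝ) ≠ 0 := by positivity
    simp only [Finset.sum_const, Finset.card_univ, Fintype.card_fin, nsmul_eq_mul]
    field_simp

end

theorem average_ge_of_forall_ge {N : ℕ} (hN : 0 < N) {s : Fin N → ℝ} {r : ℝ} (h : ∀ i, r ≤ s i) :
    r ≤ (1 / (N : ℝ)) * ∑ i, s i := by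
  have h1 : (N : ℝ) * r ≤ ∑ i, s i := by
    simpa using Finset.card_nsmul_le_sum Finset.univ s r fun i _ => h i
  have : (0 : ℝ) < N := by positivity
  rw [one_div, le_inv_mul_iff₀ this]
  exact h1

/-! ### The expectation and CVaR cases -/

section

variable {N : ℕ} (D : Data K) (nrm : Seminorm ℝ (Lifted K)) (Zhat : Fin N → Lifted K)

theorem expectationValue_le_worstCaseDual (hN : 0 < N) (ε : ℝ) :
    expectationValue D nrm Zhat ε ≤ worstCaseDual D := by
  refine le_iInf fun τ => le_iInf fun y => le_iInf fun ⟨hτ, hy, hmem⟩ => ?_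
  refine value_le_of_certificates hN 0 _ ![τ] ![y] ?_ ?_ ?_ ?_ <;>
    simp only [Fin.forall_fin_one, Matrix.cons_val_zero]
  exacts [hτ, hy, hmem, by linarith]

theorem cvarValue_le_worstCaseDual (hN : 0 < N) {α : ℝ} (hα : 0 < α) (ε : ℝ) :
    cvarValue D nrm Zhat α ε ≤ worstCaseDual D := by
  refine le_iInf fun τ => le_iInf fun y => le_iInf fun ⟨hτ, hy, hmem⟩ => ?_
  have hi : 0 ≤ α⁻¹ := inv_nonneg.2 hα.le
  -- With `t = -D.c₀ * τ` and the first multipliers scaled by `α⁻¹`, both pieces are certified at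
  -- exactly `-D.c₀ * τ`.
  refine value_le_of_certificates hN (-D.c₀ * τ) _ ![α⁻¹ * τ, 0] ![α⁻¹ • y, 0] ?_ ?_ ?_ ?_ <;>
    simp only [Fin.forall_fin_two, Matrix.cons_val_zero, Matrix.cons_val_one]
  · exact ⟨mul_nonneg hi hτ, le_rfl⟩
  · exact ⟨fun m => mul_nonneg hi (hy m), fun m => le_rfl⟩
  · refine ⟨?_, by simpa [Data.adjS_zero] using zero_mem_psdCone⟩
    convert smul_mem_psdCone hmem hi using 1
    rw [Data.adjS_smul]
    module
  · exact ⟨by linarith, by linarith⟩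

/-- The combination of the two pieces with weights `α` and `1 - α` cancels `t`. -/
theorem perf_le_of_cvar_pieces {D : Data K} {Z : Lifted K} {α t s : ℝ} (hα : 0 < α) (hα1 : α ≤ 1)
    (h0 : (1 - α⁻¹) * t + pairing (α⁻¹ • D.obj) Z ≤ s) (h1 : t ≤ s) : D.perf Z ≤ s := by
  rw [pairing_smul_left] at h0
  have h2 := mul_le_mul_of_nonneg_left h0 hα.le
  have h3 := mul_le_mul_of_nonneg_left h1 (sub_nonneg.2 hα1)
  have h4 : α * ((1 - α⁻¹) * t + α⁻¹ * pairing D.obj Z) = (α - 1) * t + pairing D.obj Z := by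
    field_simp
  rw [Data.perf]
  linarith

variable {D nrm Zhat}

theorem worstCase_le_expectationValue (hN : 0 < N) (hnrm : ∀ Z, nrm Z = 0 → Z = 0) {ε : ℝ}
    (hε : ∀ i, ∀ Z ∈ D.functionClass ∩ D.initialSet, nrm (Zhat i - Z) ≤ ε) :
    worstCase D ≤ expectationValue D nrm Zhat ε := by
  refine iSup₂_le fun Z hZ => le_value fun v hv => EReal.coe_le_coe_iff.2 ?_
  refine average_ge_of_forall_ge hN fun i => ?_
  simpa [Data.perf] using hv.loss_le hnrm hZ i (hε i Z hZ) 0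

theorem worstCase_le_cvarValue (hN : 0 < N) (hnrm : ∀ Z, nrm Z = 0 → Z = 0) {α ε : ℝ}
    (hα : 0 < α) (hα1 : α ≤ 1)
    (hε : ∀ i, ∀ Z ∈ D.functionClass ∩ D.initialSet, nrm (Zhat i - Z) ≤ ε) :
    worstCase D ≤ cvarValue D nrm Zhat α ε := by
  refine iSup₂_le fun Z hZ => le_value fun v hv => EReal.coe_le_coe_iff.2 ?_
  refine average_ge_of_forall_ge hN fun i => perf_le_of_cvar_pieces hα hα1
    (hv.loss_le hnrm hZ i (hε i Z hZ) 0) (t := v.t) ?_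
  simpa [pairing_zero_left] using hv.loss_le hnrm hZ i (hε i Z hZ) 1

theorem sampleAverage_le_expectationValue (hnrm : ∀ Z, nrm Z = 0 → Z = 0)
    (hZ : ∀ i, Zhat i ∈ D.functionClass ∩ D.initialSet) {ε : ℝ} (hε : 0 ≤ ε) :
    ((sampleAverage D Zhat : ℝ) : EReal) ≤ expectationValue D nrm Zhat ε := by
  refine le_value fun v hv => EReal.coe_le_coe_iff.2 ?_
  refine mul_le_mul_of_nonneg_left (Finset.sum_le_sum fun i _ => ?_) (by positivity)
  simpa [Data.perf] using hv.loss_le hnrm (hZ i) i (by simpa using hε) 0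

theorem expectationValue_le_add (hN : 0 < N) (hnrm : ∀ Z, nrm Z = 0 → Z = 0) (ε : ℝ) :
    expectationValue D nrm Zhat ε ≤
      ((sampleAverage D Zhat + dualNorm nrm (-D.obj) * ε : ℝ) : EReal) := by
  simpa [expectationValue, sampleAverage] using
    value_le_add (D := D) (nrm := nrm) (Zhat := Zhat) (L := ![D.obj]) (c := ![0])
      (ε := ε) hN hnrm 0 (s := fun i => D.perf (Zhat i)) (by simp [Data.perf])

theorem cvar_average_eq (hN : 0 < N) (α t : ℝ) :
    (1 / (N : ℝ)) * ∑ i, (t + α⁻¹ * max (D.perf (Zhat i) - t) 0) =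
      t + (α⁻¹ / (N : ℝ)) * ∑ i, max (D.perf (Zhat i) - t) 0 := by
  have : (N : ℝ) ≠ 0 := by positivity
  rw [Finset.sum_add_distrib, ← Finset.mul_sum]
  simp only [Finset.sum_const, Finset.card_univ, Fintype.card_fin, nsmul_eq_mul]
  field_simp

theorem sampleCVaR_le_cvarValue (hN : 0 < N) (hnrm : ∀ Z, nrm Z = 0 → Z = 0)
    (hZ : ∀ i, Zhat i ∈ D.functionClass ∩ D.initialSet) {α ε : ℝ} (hα : 0 < α) (hε : 0 ≤ ε) :
    sampleCVaR D Zhat α ≤ cvarValue D nrm Zhat α ε := by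
  refine le_value fun v hv => iInf_le_of_le v.t (EReal.coe_le_coe_iff.2 ?_)
  rw [← cvar_average_eq hN]
  refine mul_le_mul_of_nonneg_left (Finset.sum_le_sum fun i _ => ?_) (by positivity)
  have h0 := hv.loss_le hnrm (hZ i) i (by simpa using hε) 0
  have h1 := hv.loss_le hnrm (hZ i) i (by simpa using hε) 1
  simp only [Matrix.cons_val_zero, Matrix.cons_val_one, pairing_smul_left,
    pairing_zero_left] at h0 h1
  -- The CVaR integrand becomes the maximum of the two loss pieces.
  rw [mul_max_of_nonneg _ _ (inv_nonneg.2 hα.le), ← max_add_add_left]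
  refine max_le ?_ (by linarith)
  rw [Data.perf]
  linarith

theorem cvarValue_le_add (hN : 0 < N) (hnrm : ∀ Z, nrm Z = 0 → Z = 0) {α : ℝ} (hα : 0 < α)
    (ε t : ℝ) : cvarValue D nrm Zhat α ε ≤
      ((t + (α⁻¹ / (N : ℝ)) * ∑ i, max (D.perf (Zhat i) - t) 0 +
        (∑ j, dualNorm nrm (-(![α⁻¹ • D.obj, 0] : Fin 2 → Lifted K) j)) * ε : ℝ) : EReal) := by
  rw [← cvar_average_eq hN]
  have hi := inv_nonneg.2 hα.le
  refine value_le_add hN hnrm t fun i => ?_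
  simp only [Fin.forall_fin_two, Matrix.cons_val_zero, Matrix.cons_val_one, pairing_smul_left,
    pairing_zero_left]
  have h0 := mul_le_mul_of_nonneg_left (le_max_left (D.perf (Zhat i) - t) 0) hi
  have h1 := mul_nonneg hi (le_max_right (D.perf (Zhat i) - t) 0)
  rw [Data.perf] at h0 h1
  exact ⟨by rw [Data.perf]; linarith, by rw [Data.perf]; linarith⟩

theorem tendsto_expectationValue (hN : 0 < N) (hnrm : ∀ Z, nrm Z = 0 → Z = 0)
    (hZ : ∀ i, Zhat i ∈ D.functionClass ∩ D.initialSet) :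
    Tendsto (fun ε : ℝ => expectationValue D nrm Zhat ε) (𝓝[>] 0)
      (𝓝 ((sampleAverage D Zhat : ℝ) : EReal)) := by
  have hlim : Tendsto (fun ε : ℝ =>
      ((sampleAverage D Zhat + dualNorm nrm (-D.obj) * ε : ℝ) : EReal)) (𝓝[>] 0)
      (𝓝 ((sampleAverage D Zhat : ℝ) : EReal)) := by
    refine ((continuous_coe_real_ereal.comp (by fun_prop :
      Continuous fun ε => sampleAverage D Zhat + dualNorm nrm (-D.obj) * ε)).tendsto' 0 _
        (by simp)).mono_left nhdsWithin_le_nhds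
  refine tendsto_of_tendsto_of_tendsto_of_le_of_le' tendsto_const_nhds hlim ?_ ?_
  · filter_upwards [self_mem_nhdsWithin] with ε hε
    exact sampleAverage_le_expectationValue hnrm hZ (le_of_lt hε)
  · exact Eventually.of_forall fun ε => expectationValue_le_add hN hnrm ε

theorem tendsto_cvarValue (hN : 0 < N) (hnrm : ∀ Z, nrm Z = 0 → Z = 0)
    (hZ : ∀ i, Zhat i ∈ D.functionClass ∩ D.initialSet) {α : ℝ} (hα : 0 < α) :
    Tendsto (fun ε : ℝ => cvarValue D nrm Zhat α ε) (𝓝[>] 0) (𝓝 (sampleCVaR D Zhat α)) := by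
  refine tendsto_order.2 ⟨fun a ha => ?_, fun a ha => ?_⟩
  · filter_upwards [self_mem_nhdsWithin] with ε hε
    exact ha.trans_le (sampleCVaR_le_cvarValue hN hnrm hZ hα (le_of_lt hε))
  -- The limit is an infimum over `t`, so a single `t` that nearly attains it is fixed before `ε`
  -- tends to zero.
  · obtain ⟨t, ht⟩ := iInf_lt_iff.1 ha
    have hlim : Tendsto (fun ε : ℝ =>
        ((t + (α⁻¹ / (N : ℝ)) * ∑ i, max (D.perf (Zhat i) - t) 0 +
          (∑ j, dualNorm nrm (-(![α⁻¹ • D.obj, 0] : Fin 2 → Lifted K) j)) * ε : ℝ) : EReal))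
        (𝓝[>] 0) (𝓝 ((t + (α⁻¹ / (N : ℝ)) * ∑ i, max (D.perf (Zhat i) - t) 0 : ℝ) : EReal)) :=
      ((continuous_coe_real_ereal.comp (continuous_const.add
        (continuous_const.mul continuous_id))).tendsto' 0 _ (by simp)).mono_left
          nhdsWithin_le_nhds
    filter_upwards [hlim.eventually_lt_const ht] with ε hε
    exact (cvarValue_le_add hN hnrm hα ε t).trans_lt hε

end

/-! ### Weight representation of the in-sample CVaR -/

/-- A quantile: a value of `g` with at most `a` values strictly above it and at least `a` values
greater than or equal to it. -/
theorem exists_quantile {N : ℕ} (hN : 0 < N) (g : Fin N → ℝ) {a : ℝ} (ha0 : 0 ≤ a) (ha : a ≤ N) :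
    ∃ k, (Finset.card {i | g k < g i} : ℝ) ≤ a ∧ a ≤ Finset.card {i | g k ≤ g i} := by
  have : NeZero N := ⟨hN.ne'⟩
  obtain ⟨b, -, hb⟩ := Finset.exists_min_image Finset.univ g Finset.univ_nonempty
  let T : Finset (Fin N) := {k | a ≤ Finset.card {i | g k ≤ g i}}
  have hT : T.Nonempty := by
    refine ⟨b, Finset.mem_filter.2 ⟨Finset.mem_univ _, ?_⟩⟩
    rw [Finset.filter_true_of_mem fun i hi => hb i hi]
    simpa using ha
  obtain ⟨k, hk, hmax⟩ := Finset.exists_max_image T g hT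
  refine ⟨k, ?_, (Finset.mem_filter.1 hk).2⟩
  rcases (Finset.univ.filter fun i => g k < g i).eq_empty_or_nonempty with h | h
  · rw [h]
    simpa using ha0
  -- `g l` is the next value above `g k`. Maximality of `k` puts `l` outside `T`, and the indices
  -- strictly above `g k` are all at or above `g l`.
  · obtain ⟨l, hl, hmin⟩ := Finset.exists_min_image _ g h
    have hkl : g k < g l := (Finset.mem_filter.1 hl).2
    have hlT : l ∉ T := fun h' => (hmax l h').not_gt hkl
    have hlt : (Finset.card {i | g l ≤ g i} : ℝ) < a := by
      by_contra! h'
      exact hlT (Finset.mem_filter.2 ⟨Finset.mem_univ _, h'⟩)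
    refine le_trans ?_ hlt.le
    exact_mod_cast Finset.card_le_card fun i hi =>
      Finset.mem_filter.2 ⟨Finset.mem_univ _, hmin i hi⟩

/-- Weights in `[0, 1]` of total mass `a` that are concentrated on the largest values of `g`. -/
theorem exists_weights_sum_eq {N : ℕ} (hN : 0 < N) (g : Fin N → ℝ) {a : ℝ} (ha0 : 0 ≤ a)
    (ha : a ≤ N) : ∃ (t : ℝ) (w : Fin N → ℝ), (∀ i, w i ∈ Set.Icc (0 : ℝ) 1) ∧ ∑ i, w i = a ∧
      ∀ i, w i * (g i - t) = max (g i - t) 0 := by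
  obtain ⟨k, hk1, hk2⟩ := exists_quantile hN g ha0 ha
  set p : ℝ := (Finset.card {i | g k < g i} : ℝ) with hp
  set q : ℝ := (Finset.card {i | g i = g k} : ℝ) with hq
  have hpq : (Finset.card {i | g k ≤ g i} : ℝ) = p + q := by
    rw [hp, hq, ← Nat.cast_add, ← Finset.card_union_of_disjoint]
    · congr 2
      ext i
      simp [le_iff_lt_or_eq, eq_comm]
    · exact Finset.disjoint_filter.2 fun i _ h1 h2 => h1.ne' h2
  have hq0 : 0 < q := by
    rw [hq]
    exact_mod_cast Finset.card_pos.2 ⟨k, by simp⟩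
  -- Weight one strictly above the quantile; the remaining mass `a - p` is shared equally among the
  -- `q` ties.
  refine ⟨g k, fun i => if g k < g i then 1 else if g i = g k then (a - p) / q else 0, ?_, ?_, ?_⟩
  · intro i
    dsimp only
    split_ifs
    · simp
    · exact ⟨div_nonneg (by linarith) hq0.le, (div_le_one hq0).2 (by linarith)⟩
    · simp
  · have : ∀ i, (if g k < g i then (1 : ℝ) else if g i = g k then (a - p) / q else 0) =
        (if g k < g i then 1 else 0) + (a - p) / q * (if g i = g k then 1 else 0) := by
      intro i
      split_ifs with h1 h2
      · exact absurd h2 h1.ne'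
      all_goals simp
    simp only [this, Finset.sum_add_distrib, ← Finset.mul_sum, Finset.sum_boole, ← hp, ← hq]
    field_simp
    ring
  · intro i
    dsimp only
    split_ifs with h1 h2
    · rw [one_mul, max_eq_left (by linarith)]
    · simp [h2]
    · rw [zero_mul, max_eq_right (by linarith)]

/-- Linear programming duality for the conditional value-at-risk of a finite sample. -/
theorem sampleCVaR_eq_sampleCVaRWeights {N : ℕ} (hN : 0 < N) (D : Data K)
    (Zhat : Fin N → Lifted K) {α : ℝ} (hα : 0 < α) (hα1 : α ≤ 1) :
    sampleCVaR D Zhat α = sampleCVaRWeights D Zhat α := by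
  have hN' : (0 : ℝ) < N := by positivity
  have hmass : ∀ a : Fin N → ℝ, (1 / (N : ℝ)) * ∑ i, a i = α ↔ ∑ i, a i = α * N := by
    intro a
    rw [one_div, inv_mul_eq_iff_eq_mul₀ hN'.ne', mul_comm α]
  -- Fixed total mass allows any `t` to be split off, so weak duality reduces to a termwise
  -- comparison and the quantile gives equality.
  have hsplit : ∀ (a : Fin N → ℝ) (t : ℝ), ∑ i, a i = α * N →
      (α⁻¹ / (N : ℝ)) * ∑ i, a i * D.perf (Zhat i) =
        t + (α⁻¹ / (N : ℝ)) * ∑ i, a i * (D.perf (Zhat i) - t) := by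
    intro a t ha
    simp only [mul_sub, Finset.sum_sub_distrib, ← Finset.sum_mul, ha]
    field_simp
    ring
  refine le_antisymm ?_ ?_
  · obtain ⟨t, w, hw, hsum, hmax⟩ := exists_weights_sum_eq hN (fun i => D.perf (Zhat i))
      (a := α * N) (by positivity) (by nlinarith)
    refine (iInf_le _ t).trans ((le_of_eq ?_).trans (le_iSup₂ w ⟨hw, (hmass w).2 hsum⟩))
    rw [hsplit w t hsum]
    simp only [hmax]
  · refine iSup₂_le fun a ha => le_iInf fun t => EReal.coe_le_coe_iff.2 ?_
    rw [hsplit a t ((hmass a).1 ha.2)]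
    refine add_le_add_right (mul_le_mul_of_nonneg_left (Finset.sum_le_sum fun i _ => ?_)
      (by positivity)) t
    rcases le_total 0 (D.perf (Zhat i) - t) with h | h
    · exact (mul_le_of_le_one_left h (ha.1 i).2).trans (le_max_left _ _)
    · exact (mul_nonpos_of_nonneg_of_nonpos (ha.1 i).1 h).trans (le_max_right _ _)

/-! ### Large radii and the main theorem -/

theorem exists_radius {N : ℕ} (D : Data K) (nrm : Seminorm ℝ (Lifted K))
    (Zhat : Fin N → Lifted K) (hcomp : IsCompact (D.functionClass ∩ D.initialSet)) :
    ∃ R : ℝ, 0 < R ∧ ∀ i, ∀ Z ∈ D.functionClass ∩ D.initialSet, nrm (Zhat i - Z) ≤ R := by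
  obtain ⟨C, hC⟩ := nrm.exists_forall_le_of_isCompact hcomp
  have hsum : ∀ i, nrm (Zhat i) ≤ ∑ i, nrm (Zhat i) := fun i =>
    Finset.single_le_sum (f := fun i => nrm (Zhat i)) (fun _ _ => apply_nonneg nrm _)
      (Finset.mem_univ i)
  have hnn : 0 ≤ ∑ i, nrm (Zhat i) := Finset.sum_nonneg fun _ _ => apply_nonneg nrm _
  refine ⟨∑ i, nrm (Zhat i) + |C| + 1, by positivity, fun i Z hZ => ?_⟩
  have := map_sub_le_add nrm (Zhat i) Z
  linarith [hsum i, hC Z hZ, le_abs_self C]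

end DroPep

theorem mainTheorem3 (K N : ℕ) (hN : 0 < N) (D : DroPep.Data K)
    (nrm : Seminorm ℝ (DroPep.Lifted K)) (hnrm : ∀ Z, nrm Z = 0 → Z = 0)
    (Zhat : Fin N → DroPep.Lifted K) (hZ : ∀ i, Zhat i ∈ D.functionClass ∩ D.initialSet) :
    (Tendsto (fun ε : ℝ => DroPep.expectationValue D nrm Zhat ε) (𝓝[>] 0)
        (𝓝 ((DroPep.sampleAverage D Zhat : ℝ) : EReal)) ∧
      ∀ α : ℝ, 0 < α → α ≤ 1 →
        Tendsto (fun ε : ℝ => DroPep.cvarValue D nrm Zhat α ε) (𝓝[>] 0)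
          (𝓝 (DroPep.sampleCVaR D Zhat α)) ∧
        DroPep.sampleCVaR D Zhat α = DroPep.sampleCVaRWeights D Zhat α) ∧
    (IsCompact (D.functionClass ∩ D.initialSet) →
      DroPep.worstCase D = DroPep.worstCaseDual D ∧
      ∃ εbar : ℝ, 0 < εbar ∧ ∀ ε : ℝ, εbar ≤ ε →
        DroPep.expectationValue D nrm Zhat ε = DroPep.worstCase D ∧
        ∀ α : ℝ, 0 < α → α ≤ 1 →
          DroPep.cvarValue D nrm Zhat α ε = DroPep.worstCase D) := by
  refine ⟨⟨DroPep.tendsto_expectationValue hN hnrm hZ, fun α hα hα1 =>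
    ⟨DroPep.tendsto_cvarValue hN hnrm hZ hα,
      DroPep.sampleCVaR_eq_sampleCVaRWeights hN D Zhat hα hα1⟩⟩, fun hcomp => ?_⟩
  have hdual := DroPep.worstCase_eq_worstCaseDual D hcomp (hZ ⟨0, hN⟩)
  obtain ⟨R, hR, hdist⟩ := DroPep.exists_radius D nrm Zhat hcomp
  refine ⟨hdual, R, hR, fun ε hε => ?_⟩
  have hdist' : ∀ i, ∀ Z ∈ D.functionClass ∩ D.initialSet, nrm (Zhat i - Z) ≤ ε :=
    fun i Z hZ => (hdist i Z hZ).trans hε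
  exact ⟨le_antisymm (hdual ▸ DroPep.expectationValue_le_worstCaseDual D nrm Zhat hN ε)
      (DroPep.worstCase_le_expectationValue hN hnrm hdist'),
    fun α hα hα1 => le_antisymm (hdual ▸ DroPep.cvarValue_le_worstCaseDual D nrm Zhat hN hα ε)
      (DroPep.worstCase_le_cvarValue hN hnrm hα hα1 hdist')⟩
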